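/- There exists a real vector subspace $V$ of $C([0,1],\mathbb{R})$ with $\dim_{\mathbb{R}} V = 2^{\aleph_0}$ such that every non-zero $f\in V$ has the following properties: (i) for every $\alpha\in(0,1)$ the function $f$ is $\alpha$-Hölder, that is, there is a constant $C$ with $|f(x)-f(y)|\le C|x-y|^{\alpha}$ for all $x,y\in[0,1]$; (ii) $f$ has a finite one-sided derivative at no point of $[0,1]$, that is, $f$ has no finite right derivative at any $x\in[0,1)$ and no finite left derivative at any $x\in(0,1]$; (iii) for every $y\in\mathbb{R}$ the level set $\{x\in[0,1]: f(x)=y\}$ has Hausdorff dimension $0$ (where the empty set has dimension $0$). -/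

import Mathlib

/-- `f : [0,1] → ℝ` has a finite right derivative at `x`, where `0 ≤ x < 1`. The constant extension
of `f` to `ℝ` agrees with `f` on `[x, 1]`, so it does not affect the right derivative at `x < 1`. -/
def HasFiniteRightDerivAt (f : C(unitInterval, ℝ)) (x : unitInterval) : Prop :=
  x < 1 ∧ ∃ d : ℝ,
    HasDerivWithinAt (Set.IccExtend (zero_le_one' ℝ) f) d (Set.Ioi (x : ℝ)) (x : ℝ)

/-- `f : [0,1] → ℝ` has a finite left derivative at `x`, where `0 < x ≤ 1`. -/
def HasFiniteLeftDerivAt (f : C(unitInterval, ℝ)) (x : unitInterval) : Prop :=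
  0 < x ∧ ∃ d : ℝ,
    HasDerivWithinAt (Set.IccExtend (zero_le_one' ℝ) f) d (Set.Iio (x : ℝ)) (x : ℝ)

/-! Take `f = ∑ cₙ φ(2 ^ n! x)`, with `φ` the distance to the nearest integer and `cₙ = wₙ 2 ^ n² /
2 ^ n!`, where `A ≤ |wₙ|` eventually and `|wₙ| ≤ B 2 ^ n`. Since `n²` is negligible against `n!`,
`f` is Hölder of every order below one. The slopes `|wₙ| 2 ^ n²` tend to infinity, and each
eventually exceeds eight times the sum of the earlier ones, so at scale `2 ^ (-n!)` the `n`-th term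
wins. Well-chosen steps are periods of all later terms and have unbounded difference quotients on
both sides (`eventually_exists_steep`). On a monotonicity cell of the `n`-th term, a level set has
diameter `O(2 ^ (-(n+1)!/2))`, which the `O(2 ^ n!)` cells cannot offset (`dimH_level`).

For the space, let `wₙ = rⁿ` with `r ∈ (1, 2)`. A nontrivial combination has weights `∑ lᵣ rⁿ`,
governed by the largest `r` present, and so satisfies the same bounds (`isSteep_expSum`). -/

open Filter Topology Nat

/-! ### The triangle wave -/

/-- The distance from `x` to the nearest integer. -/
noncomputable def triangleWave (x : ℝ) : ℝ := ‖(x : UnitAddCircle)‖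

lemma triangleWave_nonneg (x : ℝ) : 0 ≤ triangleWave x := norm_nonneg _

lemma triangleWave_le_half (x : ℝ) : triangleWave x ≤ 1 / 2 := by
  rw [triangleWave, UnitAddCircle.norm_eq]
  exact abs_sub_round x

lemma triangleWave_eq_abs {x : ℝ} (k : ℤ) (h : |x - k| ≤ 1 / 2) : triangleWave x = |x - k| := by
  have h1 : ((x - k : ℝ) : UnitAddCircle) = x := by
    rw [AddCircle.coe_sub, sub_eq_self]
    exact (AddCircle.coe_eq_zero_iff 1).2 ⟨k, by simp⟩
  rw [triangleWave, ← h1]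
  exact (AddCircle.norm_coe_eq_abs_iff 1 one_ne_zero).2 (by simpa using h)

lemma triangleWave_neg (x : ℝ) : triangleWave (-x) = triangleWave x := by
  simp [triangleWave]

lemma triangleWave_add_int (x : ℝ) (k : ℤ) : triangleWave (x + k) = triangleWave x := by
  have h : ((k : ℝ) : UnitAddCircle) = 0 := (AddCircle.coe_eq_zero_iff 1).2 ⟨k, by simp⟩
  rw [triangleWave, AddCircle.coe_add, h, add_zero, triangleWave]

lemma abs_triangleWave_sub_le (x y : ℝ) : |triangleWave x - triangleWave y| ≤ |x - y| := by
  refine (abs_norm_sub_norm_le _ _).trans ?_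
  rw [← AddCircle.coe_sub, UnitAddCircle.norm_eq]
  simpa using round_le (x - y) 0

lemma abs_triangleWave_sub_le_half (x y : ℝ) : |triangleWave x - triangleWave y| ≤ 1 / 2 := by
  have := triangleWave_nonneg x
  have := triangleWave_nonneg y
  have := triangleWave_le_half x
  have := triangleWave_le_half y
  rw [abs_le]
  constructor <;> linarith

/-- The Lipschitz bound suffices at distance at most one, the bound on the oscillation beyond it. -/
lemma abs_triangleWave_sub_le_rpow {α : ℝ} (h0 : 0 ≤ α) (h1 : α ≤ 1) (x y : ℝ) :
    |triangleWave x - triangleWave y| ≤ |x - y| ^ α := by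
  rcases le_total |x - y| 1 with h | h
  · refine (abs_triangleWave_sub_le x y).trans ?_
    rcases (abs_nonneg (x - y)).eq_or_lt with h2 | h2
    · rw [← h2]
      positivity
    · simpa using Real.rpow_le_rpow_of_exponent_ge h2 h h1
  · have := abs_triangleWave_sub_le_half x y
    have := Real.one_le_rpow h h0
    linarith

lemma abs_triangleWave_sub_eq {x y : ℝ} (j : ℤ) (hx : x ∈ Set.Icc ((j : ℝ) / 2) ((j + 1) / 2))
    (hy : y ∈ Set.Icc ((j : ℝ) / 2) ((j + 1) / 2)) :
    |triangleWave x - triangleWave y| = |x - y| := by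
  obtain ⟨hx1, hx2⟩ := hx
  obtain ⟨hy1, hy2⟩ := hy
  rcases Int.even_or_odd' j with ⟨k, rfl | rfl⟩
  · push_cast at *
    have e : ∀ z : ℝ, (2 * k : ℝ) / 2 ≤ z → z ≤ (2 * k + 1) / 2 → triangleWave z = z - k := by
      intro z h1 h2
      have h3 : 0 ≤ z - k := by linarith
      rw [triangleWave_eq_abs k (by rw [abs_of_nonneg h3]; linarith), abs_of_nonneg h3]
    rw [e x hx1 hx2, e y hy1 hy2]
    congr 1
    ring
  · push_cast at *
    have e : ∀ z : ℝ, (2 * k + 1 : ℝ) / 2 ≤ z → z ≤ (2 * k + 1 + 1) / 2 →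
        triangleWave z = k + 1 - z := by
      intro z h1 h2
      have h3 : z - ((k + 1 : ℤ) : ℝ) ≤ 0 := by push_cast; linarith
      rw [triangleWave_eq_abs (k + 1) (by rw [abs_of_nonpos h3]; push_cast; linarith),
        abs_of_nonpos h3]
      push_cast
      ring
    rw [e x hx1 hx2, e y hy1 hy2, abs_sub_comm x y]
    congr 1
    ring

/-- A quarter step fails only near 3/8 and 7/8 modulo one, a half step only near 1/4 and 3/4, so one
of the two always works. -/
lemma exists_quarter_step_triangleWave (u : ℝ) :
    ∃ m : ℕ, (m = 1 ∨ m = 2) ∧ 1 / 8 ≤ |triangleWave (u + m / 4) - triangleWave u| := by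
  wlog hu : 0 ≤ u ∧ u < 1 generalizing u
  · obtain ⟨m, hm, h⟩ := this (Int.fract u) ⟨Int.fract_nonneg u, Int.fract_lt_one u⟩
    refine ⟨m, hm, ?_⟩
    rw [← triangleWave_add_int _ ⌊u⌋, ← triangleWave_add_int (Int.fract u) ⌊u⌋] at h
    rwa [add_right_comm, Int.fract_add_floor] at h
  obtain ⟨h0, h1⟩ := hu
  have val : ∀ (z : ℝ) (k : ℤ), k - 1 / 2 ≤ z → z ≤ k + 1 / 2 →
      triangleWave z = |z - k| := fun z k h2 h3 =>
    triangleWave_eq_abs k (by rw [abs_le]; constructor <;> linarith)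
  have v0 : u ≤ 1 / 2 → triangleWave u = u := fun h => by
    rw [val u 0 (by push_cast; linarith) (by push_cast; linarith)]
    simp [abs_of_nonneg h0]
  have v1 : 1 / 2 ≤ u → triangleWave u = 1 - u := fun h => by
    rw [val u 1 (by push_cast; linarith) (by push_cast; linarith), abs_of_nonpos] <;>
      push_cast <;> linarith
  by_cases hq : (3 / 16 ≤ u ∧ u ≤ 5 / 16) ∨ (11 / 16 ≤ u ∧ u ≤ 13 / 16)
  · refine ⟨1, Or.inl rfl, ?_⟩
    rcases hq with ⟨h2, h3⟩ | ⟨h2, h3⟩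
    · rw [v0 (by linarith)]
      rcases le_total u (1 / 4) with h4 | h4
      · rw [val _ 0 (by push_cast; linarith) (by push_cast; linarith), le_abs]
        left
        rw [abs_of_nonneg] <;> push_cast <;> linarith
      · rw [val _ 1 (by push_cast; linarith) (by push_cast; linarith), le_abs]
        left
        rw [abs_of_nonpos] <;> push_cast <;> linarith
    · rw [v1 (by linarith), val _ 1 (by push_cast; linarith) (by push_cast; linarith), le_abs]
      right
      have : |u + ((1 : ℕ) : ℝ) / 4 - ((1 : ℤ) : ℝ)| ≤ 1 / 16 := by
        rw [abs_le]
        push_cast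
        constructor <;> linarith
      linarith
  · refine ⟨2, Or.inr rfl, ?_⟩
    rcases le_total u (1 / 2) with h4 | h4
    · have e : triangleWave (u + ((2 : ℕ) : ℝ) / 4) = 1 / 2 - u := by
        rw [val _ 1 (by push_cast; linarith) (by push_cast; linarith), abs_of_nonpos] <;>
          push_cast <;> linarith
      rw [e, v0 h4, le_abs]
      by_contra hc
      push Not at hc
      exact hq (Or.inl ⟨by linarith, by linarith⟩)
    · have e : triangleWave (u + ((2 : ℕ) : ℝ) / 4) = u - 1 / 2 := by
        rw [val _ 1 (by push_cast; linarith) (by push_cast; linarith), abs_of_nonneg] <;>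
          push_cast <;> linarith
      rw [e, v1 h4, le_abs]
      by_contra hc
      push Not at hc
      exact hq (Or.inr ⟨by linarith, by linarith⟩)

/-! ### Lacunary frequencies and series -/

/-- The rapidly increasing frequencies `2 ^ n!`. -/
noncomputable def freq (n : ℕ) : ℝ := 2 ^ (n !)

lemma freq_pos (n : ℕ) : 0 < freq n := by
  unfold freq
  positivity

lemma freq_mono : Monotone freq := fun _ _ h =>
  pow_le_pow_right₀ one_le_two (Nat.factorial_le h)

lemma freq_succ (n : ℕ) : freq (n + 1) = freq n ^ (n + 1) := by
  rw [freq, freq, ← pow_mul, Nat.factorial_succ, mul_comm]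

lemma one_le_freq (n : ℕ) : 1 ≤ freq n := one_le_pow₀ one_le_two

lemma tendsto_freq : Tendsto freq atTop atTop :=
  (tendsto_pow_atTop_atTop_of_one_lt (one_lt_two (α := ℝ))).comp
    (tendsto_atTop_mono Nat.self_le_factorial tendsto_id)

/-- The factor 4 makes a quarter period of term `n` a whole number of periods of term `k`. -/
lemma exists_freq_eq_four_mul {n k : ℕ} (hn : 2 ≤ n) (hk : n < k) :
    ∃ q : ℕ, freq k = 4 * q * freq n := by
  have h : n ! + 2 ≤ k ! := by
    have h1 : (n + 1)! ≤ k ! := Nat.factorial_le hk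
    have h2 : 2 ≤ n ! := Nat.factorial_le hn
    rw [Nat.factorial_succ] at h1
    nlinarith
  obtain ⟨d, hd⟩ := Nat.exists_eq_add_of_le h
  refine ⟨2 ^ d, ?_⟩
  rw [freq, freq, hd]
  push_cast
  ring

/-- The series `∑ cₙ φ(2 ^ n! x)`, where `φ` is the distance to the nearest integer. -/
noncomputable def lacunarySeries (c : ℕ → ℝ) (x : ℝ) : ℝ := ∑' n, c n * triangleWave (freq n * x)

lemma summable_lacunarySeries {c : ℕ → ℝ} (hc : Summable fun n => |c n|) (x : ℝ) :
    Summable fun n => c n * triangleWave (freq n * x) := by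
  refine Summable.of_norm_bounded hc fun n => ?_
  rw [Real.norm_eq_abs, abs_mul, abs_of_nonneg (triangleWave_nonneg _)]
  have := triangleWave_le_half (freq n * x)
  exact mul_le_of_le_one_right (abs_nonneg _) (by linarith)

lemma continuous_lacunarySeries {c : ℕ → ℝ} (hc : Summable fun n => |c n|) :
    Continuous (lacunarySeries c) := by
  have hφ : Continuous triangleWave :=
    (LipschitzWith.of_dist_le_mul (K := 1) fun x y => by
      simpa [Real.dist_eq] using abs_triangleWave_sub_le x y).continuous
  refine continuous_tsum (fun n => by fun_prop) hc fun n x => ?_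
  rw [Real.norm_eq_abs, abs_mul, abs_of_nonneg (triangleWave_nonneg _)]
  have := triangleWave_le_half (freq n * x)
  exact mul_le_of_le_one_right (abs_nonneg _) (by linarith)

lemma lacunarySeries_sub {c : ℕ → ℝ} (hc : Summable fun n => |c n|) (x y : ℝ) :
    lacunarySeries c x - lacunarySeries c y =
      ∑' n, c n * (triangleWave (freq n * x) - triangleWave (freq n * y)) := by
  rw [lacunarySeries, lacunarySeries,
    ← (summable_lacunarySeries hc x).tsum_sub (summable_lacunarySeries hc y)]
  simp only [mul_sub]

/-- Isolates the `n`-th term: earlier terms are bounded by their slopes, while the tail is left to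
be cancelled by periodicity or estimated by size. -/
lemma abs_mul_sub_le_lacunarySeries {c : ℕ → ℝ} (hc : Summable fun n => |c n|) (x y : ℝ) (n : ℕ) :
    |c n| * |triangleWave (freq n * x) - triangleWave (freq n * y)| ≤
      |lacunarySeries c x - lacunarySeries c y| +
      (∑ k ∈ Finset.range n, |c k| * freq k) * |x - y| +
      |∑' k, c (k + (n + 1)) *
        (triangleWave (freq (k + (n + 1)) * x) - triangleWave (freq (k + (n + 1)) * y))| := by
  set δ : ℕ → ℝ := fun k => c k * (triangleWave (freq k * x) - triangleWave (freq k * y)) with hδ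
  have hs : Summable δ := by
    simpa only [hδ, mul_sub] using
      (summable_lacunarySeries hc x).sub (summable_lacunarySeries hc y)
  have h1 := hs.sum_add_tsum_nat_add (n + 1)
  rw [← lacunarySeries_sub hc, Finset.sum_range_succ] at h1
  have h2 : |∑ k ∈ Finset.range n, δ k| ≤
      (∑ k ∈ Finset.range n, |c k| * freq k) * |x - y| := by
    rw [Finset.sum_mul]
    refine (Finset.abs_sum_le_sum_abs _ _).trans (Finset.sum_le_sum fun k _ => ?_)
    rw [hδ, abs_mul, mul_assoc]
    gcongr
    refine (abs_triangleWave_sub_le _ _).trans_eq ?_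
    rw [← mul_sub, abs_mul, abs_of_pos (freq_pos k)]
  have h3 : δ n = (lacunarySeries c x - lacunarySeries c y) - ∑ k ∈ Finset.range n, δ k -
      ∑' k, δ (k + (n + 1)) := by linarith
  rw [← abs_mul]
  change |δ n| ≤ _ + _ + |∑' k, δ (k + (n + 1))|
  rw [h3]
  refine (abs_sub _ _).trans ?_
  gcongr
  exact (abs_sub _ _).trans (by gcongr)

/-! ### Steep series: Hölder bounds, difference quotients, level sets -/

/-- The conditions on the coefficients under which `lacunarySeries c` is Hölder of every order less
than one, while each of its terms is eventually much steeper than all the previous ones. -/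
structure IsSteep (c : ℕ → ℝ) : Prop where
  summable_rpow : ∀ α : ℝ, α < 1 → Summable fun n => |c n| * freq n ^ α
  sum_le : ∀ᶠ n in atTop, ∑ k ∈ Finset.range n, |c k| * freq k ≤ |c n| * freq n / 8
  tendsto_slope : Tendsto (fun n => |c n| * freq n) atTop atTop

namespace IsSteep

variable {c : ℕ → ℝ}

lemma summable (hc : IsSteep c) : Summable fun n => |c n| := by
  simpa using hc.summable_rpow 0 one_pos

lemma abs_sub_le_rpow (hc : IsSteep c) {α : ℝ} (h0 : 0 ≤ α) (h1 : α < 1) (x y : ℝ) :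
    |lacunarySeries c x - lacunarySeries c y| ≤ (∑' n, |c n| * freq n ^ α) * |x - y| ^ α := by
  rw [lacunarySeries_sub hc.summable, ← tsum_mul_right]
  refine tsum_of_norm_bounded (f := fun n => c n * _)
    (((hc.summable_rpow α h1).mul_right _).hasSum) fun n => ?_
  rw [Real.norm_eq_abs, abs_mul, mul_assoc]
  gcongr
  refine (abs_triangleWave_sub_le_rpow h0 h1.le _ _).trans_eq ?_
  rw [← mul_sub, abs_mul, abs_of_pos (freq_pos n),
    Real.mul_rpow (freq_pos n).le (abs_nonneg _)]

/-- Near every point, on either side, there are increments with arbitrarily large slopes. -/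
lemma eventually_exists_steep (hc : IsSteep c) (x : ℝ) {σ : ℝ} (hσ : σ = 1 ∨ σ = -1) :
    ∀ᶠ n in atTop, ∃ h : ℝ, 0 < h ∧ h ≤ 1 / freq n ∧
      |c n| * freq n / 8 * h ≤ |lacunarySeries c (x + σ * h) - lacunarySeries c x| := by
  filter_upwards [hc.sum_le, eventually_ge_atTop 2] with n hn hn2
  have hb := freq_pos n
  have hstep : ∃ m : ℕ, (m = 1 ∨ m = 2) ∧
      1 / 8 ≤ |triangleWave (freq n * x + σ * (m / 4)) - triangleWave (freq n * x)| := by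
    rcases hσ with rfl | rfl
    · simpa using exists_quarter_step_triangleWave (freq n * x)
    · obtain ⟨m, hm, h⟩ := exists_quarter_step_triangleWave (-(freq n * x))
      refine ⟨m, hm, ?_⟩
      rw [← triangleWave_neg, triangleWave_neg (freq n * x)] at h
      convert h using 4
      ring
  obtain ⟨m, hm, h⟩ := hstep
  have hm0 : (0 : ℝ) < m := by rcases hm with rfl | rfl <;> norm_num
  have hm2 : (m : ℝ) ≤ 2 := by rcases hm with rfl | rfl <;> norm_num
  have hle : (m : ℝ) / (4 * freq n) ≤ 1 / 2 / freq n := by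
    rw [div_div, div_le_div_iff₀ (by positivity) (by positivity)]
    nlinarith
  refine ⟨m / (4 * freq n), by positivity, hle.trans (by gcongr; norm_num), ?_⟩
  have key := abs_mul_sub_le_lacunarySeries hc.summable (x + σ * (m / (4 * freq n))) x n
  -- The step is a whole number of periods of every later term, so the tail contributes exactly
  -- zero.
  have htail : ∀ k : ℕ, triangleWave (freq (k + (n + 1)) * (x + σ * (m / (4 * freq n)))) =
      triangleWave (freq (k + (n + 1)) * x) := by
    intro k
    obtain ⟨q, hq⟩ := exists_freq_eq_four_mul hn2 (show n < k + (n + 1) by omega)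
    obtain ⟨s, hs⟩ : ∃ s : ℤ, σ = s := by
      rcases hσ with rfl | rfl
      · exact ⟨1, by simp⟩
      · exact ⟨-1, by simp⟩
    rw [← triangleWave_add_int (freq (k + (n + 1)) * x) (s * (q * m)), mul_add]
    congr 2
    rw [hq, hs]
    push_cast
    field_simp
  simp only [htail, sub_self, mul_zero, tsum_zero, abs_zero, add_zero, add_sub_cancel_left] at key
  have hσ1 : |σ| = 1 := by rcases hσ with rfl | rfl <;> simp
  rw [abs_mul, hσ1, one_mul, abs_of_pos (show 0 < (m : ℝ) / (4 * freq n) by positivity)] at key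
  have harg : freq n * (x + σ * (m / (4 * freq n))) = freq n * x + σ * (m / 4) := by
    field_simp
  rw [harg] at key
  -- The `n`-th term moves by at least `|c n| / 8`, the earlier ones by at most `|c n| / 16` in
  -- total; the remaining `|c n| / 16` is at least the required slope times the step.
  have h1 : |c n| * (1 / 8) ≤
      |c n| * |triangleWave (freq n * x + σ * (m / 4)) - triangleWave (freq n * x)| := by gcongr
  have h2 : (∑ k ∈ Finset.range n, |c k| * freq k) * (m / (4 * freq n)) ≤
      |c n| * freq n / 8 * (m / (4 * freq n)) := by gcongr
  have h3 : |c n| * freq n / 8 * (m / (4 * freq n)) ≤ |c n| / 16 := by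
    calc |c n| * freq n / 8 * (m / (4 * freq n)) ≤ |c n| * freq n / 8 * (1 / 2 / freq n) := by
          gcongr
      _ = |c n| / 16 := by field_simp; ring
  linarith

lemma not_bounded_slope (hc : IsSteep c) (x : ℝ) {σ : ℝ} (hσ : σ = 1 ∨ σ = -1) {ε : ℝ} (hε : 0 < ε)
    (C : ℝ) : ∃ h : ℝ, 0 < h ∧ h < ε ∧
      C * h < |lacunarySeries c (x + σ * h) - lacunarySeries c x| := by
  have h1 : ∀ᶠ n in atTop, 1 / freq n < ε := by
    have : Tendsto (fun n => 1 / freq n) atTop (𝓝 0) := by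
      simp only [one_div]
      exact tendsto_freq.inv_tendsto_atTop
    exact this.eventually_lt_const hε
  obtain ⟨n, ⟨h, h0, hle, hs⟩, hn, hC⟩ := ((hc.eventually_exists_steep x hσ).and
    (h1.and (hc.tendsto_slope.eventually_gt_atTop (8 * C)))).exists
  refine ⟨h, h0, hle.trans_lt hn, lt_of_lt_of_le ?_ hs⟩
  gcongr
  linarith

/-- Points of a level set in a common cell of length `1 / (2 * freq n)` are close together. -/
lemma eventually_abs_sub_le (hc : IsSteep c) : ∃ M : ℝ, 0 < M ∧ ∀ᶠ n in atTop, ∀ (j : ℕ) (x y : ℝ),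
    (j : ℝ) / 2 ≤ freq n * x → freq n * x ≤ (j + 1) / 2 →
    (j : ℝ) / 2 ≤ freq n * y → freq n * y ≤ (j + 1) / 2 →
    lacunarySeries c x = lacunarySeries c y → |x - y| ≤ M * freq (n + 1) ^ (-(1 / 2) : ℝ) := by
  have hsum := hc.summable_rpow (1 / 2) (by norm_num)
  -- The `+ 1` only serves to make the constant positive.
  refine ⟨∑' n, |c n| * freq n ^ (1 / 2 : ℝ) + 1, ?_, ?_⟩
  · have : 0 ≤ ∑' n, |c n| * freq n ^ (1 / 2 : ℝ) :=
      tsum_nonneg fun n => mul_nonneg (abs_nonneg _) (Real.rpow_nonneg (freq_pos n).le _)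
    linarith
  set M := ∑' n, |c n| * freq n ^ (1 / 2 : ℝ) with hM
  filter_upwards [hc.sum_le, hc.tendsto_slope.eventually_ge_atTop 2] with n hn hn2 j x y hx1 hx2
    hy1 hy2 hxy
  have key := abs_mul_sub_le_lacunarySeries hc.summable x y n
  rw [hxy, sub_self, abs_zero, zero_add, abs_triangleWave_sub_eq j (by simpa using ⟨hx1, hx2⟩)
    (by simpa using ⟨hy1, hy2⟩), ← mul_sub, abs_mul, abs_of_pos (freq_pos n), ← mul_assoc] at key
  have htail : |∑' k, c (k + (n + 1)) * (triangleWave (freq (k + (n + 1)) * x) -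
      triangleWave (freq (k + (n + 1)) * y))| ≤ M * freq (n + 1) ^ (-(1 / 2) : ℝ) := by
    have hsum' := (summable_nat_add_iff (n + 1)).2 hsum
    have hle : ∑' k, |c (k + (n + 1))| * freq (k + (n + 1)) ^ (1 / 2 : ℝ) ≤ M := by
      rw [hM, ← hsum.sum_add_tsum_nat_add (n + 1)]
      refine le_add_of_nonneg_left (Finset.sum_nonneg fun k _ => ?_)
      exact mul_nonneg (abs_nonneg _) (Real.rpow_nonneg (freq_pos k).le _)
    have hpos : 0 ≤ freq (n + 1) ^ (-(1 / 2) : ℝ) := Real.rpow_nonneg (freq_pos _).le _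
    refine le_trans ?_ (mul_le_mul_of_nonneg_right hle hpos)
    rw [← tsum_mul_right]
    refine tsum_of_norm_bounded (f := fun k => c (k + (n + 1)) * _)
      ((hsum'.mul_right _).hasSum) fun k => ?_
    rw [Real.norm_eq_abs, abs_mul, mul_assoc]
    gcongr
    have h1 := abs_triangleWave_sub_le_half (freq (k + (n + 1)) * x) (freq (k + (n + 1)) * y)
    -- This factor, at least 1, lets summability at `α = 1 / 2` give the decay of the tail.
    have h2 : 1 ≤ freq (k + (n + 1)) ^ (1 / 2 : ℝ) * freq (n + 1) ^ (-(1 / 2) : ℝ) := by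
      rw [Real.rpow_neg (freq_pos _).le, ← div_eq_mul_inv,
        one_le_div (Real.rpow_pos_of_pos (freq_pos _) _)]
      exact Real.rpow_le_rpow (freq_pos _).le (freq_mono (by omega)) (by norm_num)
    linarith
  have h1 : (∑ k ∈ Finset.range n, |c k| * freq k) * |x - y| ≤ |c n| * freq n / 8 * |x - y| := by
    gcongr
  have h2 : 2 * |x - y| ≤ |c n| * freq n * |x - y| := by gcongr
  have h3 : 0 ≤ freq (n + 1) ^ (-(1 / 2) : ℝ) := Real.rpow_nonneg (freq_pos _).le _
  nlinarith [abs_nonneg (x - y)]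

/-- About `2 * freq n` cells meet the level set in pieces of size `O(freq n ^ (-(n + 1) / 2))`. For
each `d > 0` the covering sums stay bounded once `n ≥ 2 / d`, so the `d`-dimensional measure is
finite. -/
lemma dimH_level (hc : IsSteep c) (y : ℝ) :
    dimH {x : unitInterval | lacunarySeries c x = y} = 0 := by
  obtain ⟨M, hM0, hM⟩ := hc.eventually_abs_sub_le
  set E := {x : unitInterval | lacunarySeries c x = y} with hE
  let r : ℕ → ENNReal := fun n => ENNReal.ofReal (M * freq (n + 1) ^ (-(1 / 2) : ℝ))
  -- The cell of `x` has index `⌊2 * freq n * x⌋`; the extra index accounts for `x = 1`.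
  let t : ∀ n : ℕ, Fin (2 * 2 ^ n ! + 1) → Set unitInterval := fun n j =>
    {x | x ∈ E ∧ (j : ℝ) / 2 ≤ freq n * x ∧ freq n * x ≤ (j + 1) / 2}
  have hr : Tendsto r atTop (𝓝 0) := by
    have h1 : Tendsto (fun n => freq (n + 1) ^ (-(1 / 2) : ℝ)) atTop (𝓝 0) :=
      (tendsto_rpow_neg_atTop (by norm_num)).comp ((tendsto_add_atTop_iff_nat 1).2 tendsto_freq)
    simpa [r] using ENNReal.tendsto_ofReal (h1.const_mul M)
  have ht : ∀ᶠ n in atTop, ∀ j, Metric.ediam (t n j) ≤ r n := by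
    filter_upwards [hM] with n hn j
    refine Metric.ediam_le fun x hx z hz => ?_
    rw [edist_dist, Subtype.dist_eq, Real.dist_eq]
    exact ENNReal.ofReal_le_ofReal
      (hn j x z hx.2.1 hx.2.2 hz.2.1 hz.2.2 (hx.1.trans hz.1.symm))
  have hst : ∀ n, E ⊆ ⋃ j, t n j := by
    intro n x hx
    have h0 : 0 ≤ 2 * (freq n * x) := by
      have := freq_pos n
      have := x.2.1
      positivity
    have h1 : 2 * (freq n * x) ≤ 2 * 2 ^ n ! := by
      have := x.2.2
      have := freq_pos n
      change 2 * (freq n * x) ≤ 2 * freq n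
      nlinarith
    have h2 := Nat.floor_le h0
    have h3 := Nat.lt_floor_add_one (2 * (freq n * x))
    have h4 : ⌊2 * (freq n * x)⌋₊ < 2 * 2 ^ n ! + 1 := by
      rw [Nat.lt_add_one_iff]
      exact Nat.floor_le_of_le (by push_cast; exact h1)
    refine Set.mem_iUnion.2 ⟨⟨_, h4⟩, hx, ?_, ?_⟩ <;> dsimp only <;> linarith
  refine le_antisymm (ENNReal.le_of_forall_pos_le_add fun d hd _ => ?_) bot_le
  rw [zero_add]
  refine dimH_le_of_hausdorffMeasure_ne_top
    (ne_top_of_le_ne_top (ENNReal.ofReal_ne_top (r := 3 * M ^ (d : ℝ))) ?_)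
  refine (MeasureTheory.Measure.hausdorffMeasure_le_liminf_sum d E r hr t ht
    (Eventually.of_forall hst)).trans ?_
  have hlarge : ∀ᶠ n : ℕ in atTop, 2 / (d : ℝ) ≤ n :=
    tendsto_natCast_atTop_atTop.eventually_ge_atTop _
  refine liminf_le_of_frequently_le' (Eventually.frequently ?_)
  filter_upwards [ht, hlarge] with n hn hnd
  have hd0 : (0 : ℝ) < d := hd
  have hb := freq_pos n
  have hpow : freq n * (freq (n + 1) ^ (-(1 / 2) : ℝ)) ^ (d : ℝ) ≤ 1 := by
    rw [freq_succ, ← Real.rpow_natCast, ← Real.rpow_mul hb.le, ← Real.rpow_mul hb.le]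
    nth_rewrite 1 [← Real.rpow_one (freq n)]
    rw [← Real.rpow_add hb]
    refine Real.rpow_le_one_of_one_le_of_nonpos (one_le_freq n) ?_
    rw [div_le_iff₀ hd0] at hnd
    push_cast
    nlinarith
  calc ∑ j, Metric.ediam (t n j) ^ (d : ℝ) ≤ ∑ _j : Fin (2 * 2 ^ n ! + 1), r n ^ (d : ℝ) :=
        Finset.sum_le_sum fun j _ => ENNReal.rpow_le_rpow (hn j) hd0.le
    _ = ENNReal.ofReal ((2 * freq n + 1) * (M * freq (n + 1) ^ (-(1 / 2) : ℝ)) ^ (d : ℝ)) := by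
        rw [Finset.sum_const, Finset.card_univ, Fintype.card_fin, nsmul_eq_mul,
          ENNReal.ofReal_rpow_of_nonneg (mul_nonneg hM0.le (Real.rpow_nonneg (freq_pos _).le _))
          hd0.le, ← ENNReal.ofReal_natCast, ← ENNReal.ofReal_mul (by positivity)]
        simp [freq]
    _ ≤ ENNReal.ofReal (3 * M ^ (d : ℝ)) := by
        refine ENNReal.ofReal_le_ofReal ?_
        have hq : 0 ≤ freq (n + 1) ^ (-(1 / 2) : ℝ) := Real.rpow_nonneg (freq_pos _).le _
        rw [Real.mul_rpow hM0.le hq]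
        have h1 := one_le_freq n
        have h2 : 0 ≤ M ^ (d : ℝ) := Real.rpow_nonneg hM0.le _
        calc (2 * freq n + 1) * (M ^ (d : ℝ) * (freq (n + 1) ^ (-(1 / 2) : ℝ)) ^ (d : ℝ))
            ≤ (3 * freq n) * (M ^ (d : ℝ) * (freq (n + 1) ^ (-(1 / 2) : ℝ)) ^ (d : ℝ)) := by
              gcongr
              linarith
          _ = 3 * M ^ (d : ℝ) * (freq n * (freq (n + 1) ^ (-(1 / 2) : ℝ)) ^ (d : ℝ)) := by ring
          _ ≤ 3 * M ^ (d : ℝ) := mul_le_of_le_one_right (by positivity) hpow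

end IsSteep

/-! ### Exponential sums as weights -/

/-- The exponential sum `∑ lᵣ rⁿ`. -/
noncomputable def expSum (l : Set.Ioo (1 : ℝ) 2 →₀ ℝ) (n : ℕ) : ℝ :=
  l.sum fun r a => a * (r : ℝ) ^ n

lemma abs_expSum_le (l : Set.Ioo (1 : ℝ) 2 →₀ ℝ) :
    ∃ B : ℝ, ∀ n, |expSum l n| ≤ B * 2 ^ n := by
  refine ⟨∑ r ∈ l.support, |l r|, fun n => ?_⟩
  rw [Finset.sum_mul]
  refine (Finset.abs_sum_le_sum_abs _ _).trans (Finset.sum_le_sum fun r _ => ?_)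
  have h0 : (0 : ℝ) ≤ r := (one_pos.trans r.2.1).le
  have h2 := r.2.2
  rw [abs_mul, abs_of_nonneg (pow_nonneg h0 n)]
  gcongr

/-- Divided by `Rⁿ`, with `R` the largest base in the support, the sum tends to `l R ≠ 0`; and `Rⁿ ≥
1`. -/
lemma exists_le_abs_expSum {l : Set.Ioo (1 : ℝ) 2 →₀ ℝ} (hl : l ≠ 0) :
    ∃ A : ℝ, 0 < A ∧ ∀ᶠ n in atTop, A ≤ |expSum l n| := by
  have hne : l.support.Nonempty := Finsupp.support_nonempty_iff.2 hl
  obtain ⟨R, hR, hmax⟩ := l.support.exists_max_image id hne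
  have hR0 : l R ≠ 0 := Finsupp.mem_support_iff.1 hR
  have hR1 : (1 : ℝ) < R := R.2.1
  have hlim : Tendsto (fun n => ∑ r ∈ l.support, l r * ((r : ℝ) / R) ^ n) atTop
      (𝓝 (∑ r ∈ l.support, if r = R then l R else 0)) := by
    refine tendsto_finsetSum _ fun r hr => ?_
    split_ifs with h
    · subst h
      have : ((r : ℝ) / r) = 1 := div_self (by linarith)
      simp [this]
    · have hlt : (r : ℝ) < R := lt_of_le_of_ne (hmax r hr) fun h' => h (Subtype.ext h')
      have h0 : (0 : ℝ) < r := one_pos.trans r.2.1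
      simpa using (tendsto_pow_atTop_nhds_zero_of_lt_one (by positivity)
        ((div_lt_one (by linarith)).2 hlt)).const_mul (l r)
  rw [Finset.sum_ite_eq' l.support R (fun _ => l R), if_pos hR] at hlim
  refine ⟨|l R| / 2, by positivity, ?_⟩
  have hpos : 0 < |l R| := abs_pos.2 hR0
  filter_upwards [hlim.abs.eventually_const_le (show |l R| / 2 < |l R| by linarith)] with n hn
  have hfac : expSum l n = (R : ℝ) ^ n * ∑ r ∈ l.support, l r * ((r : ℝ) / R) ^ n := by
    rw [expSum, Finsupp.sum, Finset.mul_sum]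
    refine Finset.sum_congr rfl fun r _ => ?_
    have : (R : ℝ) ^ n ≠ 0 := pow_ne_zero n (by linarith)
    rw [div_pow]
    field_simp
  have hRn : (1 : ℝ) ≤ (R : ℝ) ^ n := one_le_pow₀ hR1.le
  rw [hfac, abs_mul, abs_of_pos (show 0 < (R : ℝ) ^ n by linarith)]
  nlinarith

/-- The coefficients `wₙ 2 ^ n² / 2 ^ n!`, which give the `n`-th term of the series the slopes
`± wₙ 2 ^ n²`. -/
noncomputable def steepCoeff (w : ℕ → ℝ) (n : ℕ) : ℝ := w n * 2 ^ (n ^ 2) / freq n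

lemma abs_steepCoeff_mul_freq (w : ℕ → ℝ) (n : ℕ) :
    |steepCoeff w n| * freq n = |w n| * 2 ^ (n ^ 2) := by
  have := freq_pos n
  rw [steepCoeff, abs_div, abs_mul, abs_of_pos this, div_mul_cancel₀ _ this.ne',
    abs_of_pos (by positivity : (0 : ℝ) < 2 ^ (n ^ 2))]

/-- One of the two extra `n` absorbs the growth `2 ^ n` of the weights; the other leaves a summable
`2 ^ (-n)`. -/
lemma eventually_sq_le_factorial {ε : ℝ} (hε : 0 < ε) :
    ∀ᶠ n : ℕ in atTop, ((n ^ 2 + n + n : ℕ) : ℝ) ≤ ε * n ! := by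
  filter_upwards [(FloorSemiring.tendsto_pow_div_factorial_atTop (4 : ℝ)).eventually_le_const hε]
    with n hn
  rw [div_le_iff₀ (by positivity)] at hn
  refine le_trans ?_ hn
  have h : n ^ 2 + n + n ≤ 4 ^ n := by
    have h1 : n + 1 ≤ 2 ^ n := Nat.lt_two_pow_self
    have h2 : 4 ^ n = 2 ^ n * 2 ^ n := by rw [← mul_pow]; norm_num
    rw [h2]
    nlinarith
  exact_mod_cast h

lemma summable_steepCoeff {w : ℕ → ℝ} {B : ℝ} (hw : ∀ n, |w n| ≤ B * 2 ^ n) {α : ℝ} (hα : α < 1) :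
    Summable fun n => |steepCoeff w n| * freq n ^ α := by
  refine Summable.of_norm_bounded_eventually_nat (g := fun n => B * (1 / 2 : ℝ) ^ n)
    (summable_geometric_two.mul_left B) ?_
  filter_upwards [eventually_sq_le_factorial (sub_pos.2 hα)] with n hn
  have hb := freq_pos n
  have hB : 0 ≤ B := by simpa using (abs_nonneg _).trans (hw 0)
  rw [Real.norm_of_nonneg (mul_nonneg (abs_nonneg _) (Real.rpow_nonneg hb.le _))]
  have h1 : freq n ^ α = freq n * freq n ^ (α - 1) := by
    rw [Real.rpow_sub_one hb.ne']
    field_simp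
  have h2 : freq n ^ (α - 1) ≤ ((2 : ℝ) ^ (n ^ 2 + n + n))⁻¹ := by
    rw [freq, ← Real.rpow_natCast, ← Real.rpow_natCast, ← Real.rpow_mul zero_le_two,
      ← Real.rpow_neg zero_le_two]
    exact Real.rpow_le_rpow_of_exponent_le one_le_two (by nlinarith)
  rw [h1, ← mul_assoc, abs_steepCoeff_mul_freq]
  calc |w n| * 2 ^ (n ^ 2) * freq n ^ (α - 1)
      ≤ B * 2 ^ n * 2 ^ (n ^ 2) * ((2 : ℝ) ^ (n ^ 2 + n + n))⁻¹ := by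
        gcongr
        exact hw n
    _ = B * (1 / 2) ^ n := by
        rw [pow_add, pow_add, one_div, inv_pow]
        field_simp

lemma isSteep_steepCoeff {w : ℕ → ℝ} {A B : ℝ} (hA : 0 < A) (hw : ∀ n, |w n| ≤ B * 2 ^ n)
    (hwA : ∀ᶠ n in atTop, A ≤ |w n|) : IsSteep (steepCoeff w) where
  summable_rpow _ hα := summable_steepCoeff hw hα
  sum_le := by
    have hB : 0 ≤ B := by simpa using (abs_nonneg _).trans (hw 0)
    have hlim : Tendsto (fun n : ℕ => 8 * B * (n * (1 / 2 : ℝ) ^ n)) atTop (𝓝 0) := by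
      simpa using (tendsto_self_mul_const_pow_of_lt_one (r := (1 / 2 : ℝ)) (by norm_num)
        (by norm_num)).const_mul (8 * B)
    filter_upwards [hwA, hlim.eventually_le_const hA] with n hn hnA
    simp only [abs_steepCoeff_mul_freq]
    have h1 : ∀ k ∈ Finset.range n, |w k| * 2 ^ (k ^ 2) ≤ B * ((1 / 2) ^ n * 2 ^ (n ^ 2)) := by
      intro k hk
      have hk' : k + 1 ≤ n := Finset.mem_range.1 hk
      -- For `k < n` the quadratic exponent gains a factor `2 ^ (-n)`, which outweighs the number
      -- `n` of earlier terms.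
      have hexp : k + k ^ 2 + n ≤ n ^ 2 := by nlinarith
      calc |w k| * 2 ^ (k ^ 2) ≤ B * 2 ^ k * 2 ^ (k ^ 2) := by gcongr; exact hw k
        _ = B * ((1 / 2) ^ n * 2 ^ (k + k ^ 2 + n)) := by
          rw [pow_add, pow_add, one_div, inv_pow]
          field_simp
        _ ≤ B * ((1 / 2) ^ n * 2 ^ (n ^ 2)) := by
          gcongr
          norm_num
    have h2 := Finset.sum_le_sum h1
    rw [Finset.sum_const, Finset.card_range, nsmul_eq_mul] at h2
    have h3 : 8 * B * (n * (1 / 2 : ℝ) ^ n) * 2 ^ (n ^ 2) ≤ |w n| * 2 ^ (n ^ 2) := by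
      gcongr
      exact hnA.trans hn
    linarith
  tendsto_slope := by
    simp only [abs_steepCoeff_mul_freq]
    have h1 : Tendsto (fun n : ℕ => A * (2 : ℝ) ^ (n ^ 2)) atTop atTop :=
      ((tendsto_pow_atTop_atTop_of_one_lt (one_lt_two (α := ℝ))).comp
        (tendsto_pow_atTop two_ne_zero)).const_mul_atTop hA
    refine tendsto_atTop_mono' _ ?_ h1
    filter_upwards [hwA] with n hn
    gcongr

lemma abs_pow_le_two_pow (r : Set.Ioo (1 : ℝ) 2) (n : ℕ) : |(r : ℝ) ^ n| ≤ 1 * 2 ^ n := by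
  have h1 : (0 : ℝ) ≤ r := (one_pos.trans r.2.1).le
  rw [one_mul, abs_of_nonneg (pow_nonneg h1 n)]
  exact pow_le_pow_left₀ h1 r.2.2.le n

lemma summable_abs_steepCoeff_pow (r : Set.Ioo (1 : ℝ) 2) :
    Summable fun n => |steepCoeff (fun n => (r : ℝ) ^ n) n| := by
  simpa using summable_steepCoeff (abs_pow_le_two_pow r) one_pos

/-! ### The spanning functions and their combinations -/

/-- The continuous functions on `[0,1]` that span the desired space. -/
noncomputable def steepFun (r : Set.Ioo (1 : ℝ) 2) : C(unitInterval, ℝ) where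
  toFun x := lacunarySeries (steepCoeff fun n => (r : ℝ) ^ n) x
  continuous_toFun :=
    (continuous_lacunarySeries (summable_abs_steepCoeff_pow r)).comp continuous_subtype_val

/-- The series is linear in its weights, so one analysis of steep series covers the whole span. -/
lemma linearCombination_steepFun_apply (l : Set.Ioo (1 : ℝ) 2 →₀ ℝ) (x : unitInterval) :
    Finsupp.linearCombination ℝ steepFun l x = lacunarySeries (steepCoeff (expSum l)) x := by
  rw [Finsupp.linearCombination_apply, Finsupp.sum, ContinuousMap.sum_apply]
  simp only [ContinuousMap.smul_apply, smul_eq_mul, steepFun, ContinuousMap.coe_mk, lacunarySeries,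
    ← tsum_mul_left]
  rw [← Summable.tsum_finsetSum fun r _ =>
    (summable_lacunarySeries (summable_abs_steepCoeff_pow r) x).mul_left (l r)]
  refine tsum_congr fun n => ?_
  rw [steepCoeff, expSum, Finsupp.sum, Finset.sum_mul, Finset.sum_div, Finset.sum_mul]
  refine Finset.sum_congr rfl fun r _ => ?_
  rw [steepCoeff]
  ring

lemma isSteep_expSum {l : Set.Ioo (1 : ℝ) 2 →₀ ℝ} (hl : l ≠ 0) :
    IsSteep (steepCoeff (expSum l)) := by
  obtain ⟨B, hB⟩ := abs_expSum_le l
  obtain ⟨A, hA, hA'⟩ := exists_le_abs_expSum hl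
  exact isSteep_steepCoeff hA hB hA'

namespace IsSteep

variable {c : ℕ → ℝ} {f : C(unitInterval, ℝ)}

lemma exists_holderWith (hc : IsSteep c) (hf : ∀ x, f x = lacunarySeries c x) {α : NNReal}
    (hα : α < 1) : ∃ C : NNReal, HolderWith C α f := by
  refine ⟨Real.toNNReal (∑' n, |c n| * freq n ^ (α : ℝ)), fun x y => ?_⟩
  rw [edist_dist, edist_dist, Subtype.dist_eq, Real.dist_eq, Real.dist_eq,
    ENNReal.ofReal_rpow_of_nonneg (abs_nonneg _) α.coe_nonneg, hf, hf]
  change _ ≤ ENNReal.ofReal _ * _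
  rw [← ENNReal.ofReal_mul (tsum_nonneg fun n =>
    mul_nonneg (abs_nonneg _) (Real.rpow_nonneg (freq_pos n).le _))]
  exact ENNReal.ofReal_le_ofReal (hc.abs_sub_le_rpow α.coe_nonneg (mod_cast hα) x y)

lemma not_hasFiniteRightDerivAt (hc : IsSteep c) (hf : ∀ x, f x = lacunarySeries c x)
    (x : unitInterval) : ¬ HasFiniteRightDerivAt f x := by
  rintro ⟨hx, d, hd⟩
  obtain ⟨C, hC⟩ := hd.differentiableWithinAt.isBigO_sub.bound
  rw [eventually_nhdsWithin_iff, Metric.eventually_nhds_iff] at hC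
  obtain ⟨ε, hε, hC⟩ := hC
  have hx1 : (x : ℝ) < 1 := hx
  obtain ⟨h, h0, hlt, hs⟩ := hc.not_bounded_slope x (Or.inl rfl)
    (lt_min hε (sub_pos.2 hx1)) C
  rw [one_mul] at hs
  have hmem : (x : ℝ) + h ∈ Set.Icc (0 : ℝ) 1 :=
    ⟨add_nonneg x.2.1 h0.le, by linarith [hlt.trans_le (min_le_right _ _)]⟩
  have h1 := hC (y := x + h) (by simpa [abs_of_pos h0] using hlt.trans_le (min_le_left _ _))
    (by simpa using h0)
  rw [Set.IccExtend_of_mem _ _ hmem, Set.IccExtend_of_mem _ _ x.2, hf, hf, add_sub_cancel_left,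
    Real.norm_eq_abs, Real.norm_eq_abs, abs_of_pos h0] at h1
  exact hs.not_ge h1

lemma not_hasFiniteLeftDerivAt (hc : IsSteep c) (hf : ∀ x, f x = lacunarySeries c x)
    (x : unitInterval) : ¬ HasFiniteLeftDerivAt f x := by
  rintro ⟨hx, d, hd⟩
  obtain ⟨C, hC⟩ := hd.differentiableWithinAt.isBigO_sub.bound
  rw [eventually_nhdsWithin_iff, Metric.eventually_nhds_iff] at hC
  obtain ⟨ε, hε, hC⟩ := hC
  have hx0 : (0 : ℝ) < x := hx
  obtain ⟨h, h0, hlt, hs⟩ := hc.not_bounded_slope x (Or.inr rfl) (lt_min hε hx0) C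
  rw [neg_one_mul] at hs
  have hmem : (x : ℝ) + -h ∈ Set.Icc (0 : ℝ) 1 :=
    ⟨by linarith [hlt.trans_le (min_le_right _ _)], by linarith [x.2.2]⟩
  have h1 := hC (y := x + -h) (by simpa [abs_of_pos h0] using hlt.trans_le (min_le_left _ _))
    (by simpa using h0)
  rw [Set.IccExtend_of_mem _ _ hmem, Set.IccExtend_of_mem _ _ x.2, hf, hf, add_sub_cancel_left,
    Real.norm_eq_abs, Real.norm_eq_abs, abs_neg, abs_of_pos h0] at h1
  exact hs.not_ge h1

end IsSteep

/-- A nontrivial combination has no right derivative at 0, whereas the zero function does. -/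
lemma linearCombination_steepFun_injective :
    Function.Injective (Finsupp.linearCombination ℝ steepFun) := by
  refine (injective_iff_map_eq_zero _).2 fun l h => ?_
  by_contra hl
  refine (isSteep_expSum hl).not_hasFiniteRightDerivAt (f := 0)
    (fun x => by rw [← linearCombination_steepFun_apply, h]) 0 ⟨zero_lt_one, 0, ?_⟩
  exact hasDerivWithinAt_const _ _ (0 : ℝ)

/-! ### The space of dimension continuum -/

theorem mainTheorem9 :
    ∃ V : Submodule ℝ C(unitInterval, ℝ),
      Module.rank ℝ V = Cardinal.continuum ∧
      ∀ f ∈ V, f ≠ 0 →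
        (∀ α : NNReal, 0 < α → α < 1 → ∃ C : NNReal, HolderWith C α f) ∧
        (∀ x : unitInterval, ¬ HasFiniteRightDerivAt f x ∧ ¬ HasFiniteLeftDerivAt f x) ∧
        (∀ y : ℝ, dimH {x : unitInterval | f x = y} = 0) := by
  refine ⟨LinearMap.range (Finsupp.linearCombination ℝ steepFun), ?_, ?_⟩
  · rw [rank_range_of_injective _ linearCombination_steepFun_injective, rank_finsupp_self',
      Cardinal.mk_Ioo_real one_lt_two]
  · rintro _ ⟨l, rfl⟩ hl0
    have hl : l ≠ 0 := by
      rintro rfl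
      exact hl0 (map_zero _)
    have hc := isSteep_expSum hl
    have hf := linearCombination_steepFun_apply l
    refine ⟨fun α _ hα => hc.exists_holderWith hf hα,
      fun x => ⟨hc.not_hasFiniteRightDerivAt hf x, hc.not_hasFiniteLeftDerivAt hf x⟩, fun y => ?_⟩
    simp only [hf]
    exact hc.dimH_level y
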